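/- Let $n\ge 1$, $T>0$, $s\in(0,1)$, let $X:[0,T]\to\mathbb{R}^n$ be a continuous path and let $\varphi\in BV_{\mathrm{loc}}(\mathbb{R}^n)$, i.e. $\varphi:\mathbb{R}^n\to\mathbb{R}$ is locally integrable and its distributional partial derivatives $D_1\varphi,\dots,D_n\varphi$ are signed Radon measures; let $\|D\varphi\|$ be the total variation measure of the vector measure $D\varphi=(D_1\varphi,\dots,D_n\varphi)$ with respect to the Euclidean norm. Let $S_\varphi$ be the approximate discontinuity set of $\varphi$, i.e. the set of all $x\in\mathbb{R}^n$ for which there is no $\lambda\in\mathbb{R}$ with \[\lim_{r\to0}\frac{1}{\mathcal{L}^n(B(x,r))}\int_{B(x,r)}|\varphi(y)-\lambda|\,dy=0 ;\] for $x\notin S_\varphi$ the unique such $\lambda$ is denoted by $\lambda_\varphi(x)$. A Lebesgue representative of $\varphi$ is a Borel function $\widetilde\varphi:\mathbb{R}^n\to\mathbb{R}$ with $\widetilde\varphi(x)=\lambda_\varphi(x)$ for all $x\notin S_\varphi$. The occupation measure $\mu_X^{[0,T]}$ is the image of the Lebesgue measure on $[0,T]$ under $X$. Suppose that $X$ is $(s,1)$-variable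 with respect to $\varphi$: there is a relatively compact open neighborhood $\mathcal{U}$ of $X([0,T])$ such that \[ t\mapsto \int_{\mathcal{U}}|X_t-z|^{-n+1-s}\,\|D\varphi\|(dz)\quad\text{belongs to } L^1(0,T).\] Then: (i) $\mu_X^{[0,T]}(S_\varphi)=0$; (ii) $\mathcal{L}^1(\{t\in[0,T]: X_t\in S_\varphi\})=0$; (iii) the composition $\varphi\circ X$ is well defined: a Lebesgue representative $\widetilde\varphi$ of $\varphi$ exists, and the $\mathcal{L}^1$-equivalence class on $[0,T]$ of $t\mapsto\widetilde\varphi(X_t)$ does not depend on its choice; this class is denoted by $\varphi\circ X$; (iv) $\|\varphi\|_{L^\infty(X)}\le\|\varphi\|_{L^\infty(\mathbb{R}^n)}$ in $[0,+\infty]$, where $\|\varphi\|_{L^\infty(X)}:=\|\varphi\circ X\|_{L^\infty(0,T)}$. -/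

import Mathlib

open MeasureTheory Filter Topology
open scoped ENNReal

noncomputable section

namespace BVPath

/-- Euclidean space `ℝⁿ`. -/
abbrev E (n : ℕ) : Type := EuclideanSpace ℝ (Fin n)

/-- The distributional partial derivative `D_i φ` is the signed Radon measure `μp - μm`, where
`μp` and `μm` are nonnegative Radon measures (locally finite Borel measures on `ℝⁿ`):
`∫ φ ∂_i ψ dx = - ∫ ψ d(D_i φ)` for all test functions `ψ ∈ C_c^∞(ℝⁿ)`. -/
structure IsPartialDerivMeasure {n : ℕ} (φ : E n → ℝ) (i : Fin n) (μp μm : Measure (E n)) :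
    Prop where
  locallyFinite_pos : IsLocallyFiniteMeasure μp
  locallyFinite_neg : IsLocallyFiniteMeasure μm
  integral_eq : ∀ ψ : E n → ℝ, ContDiff ℝ (⊤ : ℕ∞) ψ → HasCompactSupport ψ →
    ∫ x, φ x * fderiv ℝ ψ x (EuclideanSpace.single i 1) = -(∫ x, ψ x ∂μp - ∫ x, ψ x ∂μm)

/-- `φ ∈ BV_loc(ℝⁿ)`: `φ` is locally integrable and its distributional partial derivatives are
signed Radon measures. -/
structure IsBVLoc {n : ℕ} (φ : E n → ℝ) : Prop where
  locallyIntegrable : LocallyIntegrable φ volume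
  exists_deriv : ∀ i, ∃ μp μm : Measure (E n), IsPartialDerivMeasure φ i μp μm

namespace IsBVLoc

variable {n : ℕ} {φ : E n → ℝ}

/-- A nonnegative Radon measure `μp` in a representation `D_i φ = μp - μm`. -/
def derivPos (hφ : IsBVLoc φ) (i : Fin n) : Measure (E n) :=
  (hφ.exists_deriv i).choose

/-- The matching nonnegative Radon measure `μm` in the representation `D_i φ = μp - μm`. -/
def derivNeg (hφ : IsBVLoc φ) (i : Fin n) : Measure (E n) :=
  (hφ.exists_deriv i).choose_spec.choose

theorem isPartialDerivMeasure (hφ : IsBVLoc φ) (i : Fin n) :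
    IsPartialDerivMeasure φ i (hφ.derivPos i) (hφ.derivNeg i) :=
  (hφ.exists_deriv i).choose_spec.choose_spec

/-- The value `Dφ(B) = (D_1 φ(B), …, D_n φ(B)) ∈ ℝⁿ` of the gradient measure on a bounded Borel
set `B`. (On bounded sets all measures involved are finite.) -/
def grad (hφ : IsBVLoc φ) (B : Set (E n)) : E n :=
  WithLp.toLp 2 fun i => (hφ.derivPos i).real B - (hφ.derivNeg i).real B

open scoped Classical in
/-- The set function `B ↦ |Dφ(B)|` on bounded sets, extended by `0` to unbounded sets (on which
the vector-valued Radon measure `Dφ` need not be defined). -/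
def gradNorm (hφ : IsBVLoc φ) (B : Set (E n)) : ℝ≥0∞ :=
  if Bornology.IsBounded B then ‖hφ.grad B‖ₑ else 0

theorem gradNorm_empty (hφ : IsBVLoc φ) : hφ.gradNorm ∅ = 0 := by
  have h : hφ.grad ∅ = 0 := by
    ext i
    simp [grad]
  simp [gradNorm, h]

theorem hasSum_real_iUnion {μ : Measure (E n)} [IsLocallyFiniteMeasure μ]
    {s : ℕ → Set (E n)} (hm : ∀ k, MeasurableSet (s k))
    (hd : Pairwise (Function.onFun Disjoint s)) (hb : Bornology.IsBounded (⋃ k, s k)) :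
    HasSum (fun k => μ.real (s k)) (μ.real (⋃ k, s k)) := by
  have hfin : μ (⋃ k, s k) ≠ ∞ := hb.measure_lt_top.ne
  have h := measure_iUnion (μ := μ) hd hm
  rw [Measure.real, h, ENNReal.tsum_toReal_eq]
  · exact (ENNReal.summable_toReal (h ▸ hfin)).hasSum
  · exact fun k => (hb.subset (Set.subset_iUnion s k)).measure_lt_top.ne

theorem gradNorm_sigmaSubadditive (hφ : IsBVLoc φ) :
    IsSigmaSubadditiveSetFun hφ.gradNorm := by
  intro s hs
  by_cases hb : Bornology.IsBounded (⋃ k, (s k).val)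
  · have hk : ∀ k, Bornology.IsBounded (s k).val := fun k =>
      hb.subset (Set.subset_iUnion (fun k => (s k).val) k)
    simp only [gradNorm, hb, hk, if_true]
    have hsum : HasSum (fun k => hφ.grad (s k).val) (hφ.grad (⋃ k, (s k).val)) := by
      have h : HasSum (fun k => (hφ.grad (s k).val).ofLp)
          (hφ.grad (⋃ k, (s k).val)).ofLp := by
        rw [Pi.hasSum]
        intro i
        have h1 := (hφ.isPartialDerivMeasure i).locallyFinite_pos
        have h2 := (hφ.isPartialDerivMeasure i).locallyFinite_neg
        exact (hasSum_real_iUnion (μ := hφ.derivPos i) (fun k => (s k).prop) hs hb).sub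
          (hasSum_real_iUnion (μ := hφ.derivNeg i) (fun k => (s k).prop) hs hb)
      exact h.map (WithLp.linearEquiv 2 ℝ (Fin n → ℝ)).symm.toLinearMap
        (PiLp.continuous_toLp 2 _)
    rw [← hsum.tsum_eq]
    exact enorm_tsum_le_tsum_enorm
  · simp [gradNorm, hb]

/-- The total variation `‖Dφ‖` of the gradient measure, a nonnegative Borel measure on `ℝⁿ`:
for a Borel set `B`, `‖Dφ‖(B)` is the supremum of the sums `∑ |Dφ(B_k)|` over finite families of
disjoint bounded Borel sets `B_k ⊆ B` (in a finite Borel partition of `B`, the unbounded pieces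
are counted as `0`). -/
def totalVariation (hφ : IsBVLoc φ) : Measure (E n) :=
  preVariation hφ.gradNorm hφ.gradNorm_sigmaSubadditive hφ.gradNorm_empty

end IsBVLoc

/-- The path `X : [0,T] → ℝⁿ` is `(s,p)`-variable with respect to `φ`: there is a relatively
compact open neighbourhood `U` of `X([0,T])` such that
`t ↦ ∫_U |X_t - z|^{-n+1-s} ‖Dφ‖(dz)` belongs to `L^p(0,T)`. The kernel takes the value `∞`
at `z = X_t` when its exponent is negative. -/
def IsVariable {n : ℕ} {φ : E n → ℝ} (hφ : IsBVLoc φ) (T s : ℝ) (p : ℝ≥0∞) (X : ℝ → E n) :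
    Prop :=
  ∃ U : Set (E n), IsOpen U ∧ IsCompact (closure U) ∧ X '' Set.Icc 0 T ⊆ U ∧
    MemLp (fun t => ∫⁻ z in U, ‖X t - z‖ₑ ^ (-(n : ℝ) + 1 - s) ∂hφ.totalVariation) p
      (volume.restrict (Set.Ioo 0 T))

/-- `φ` has the approximate limit `l` at `x`. -/
def HasApproxLimit {n : ℕ} (φ : E n → ℝ) (x : E n) (l : ℝ) : Prop :=
  Tendsto (fun r : ℝ => ⨍ y in Metric.ball x r, |φ y - l|) (𝓝[>] 0) (𝓝 0)

/-- The approximate discontinuity set `S_φ`. -/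
def approxDiscontSet {n : ℕ} (φ : E n → ℝ) : Set (E n) :=
  {x | ¬ ∃ l : ℝ, HasApproxLimit φ x l}

/-- `ψ` is a Lebesgue representative of `φ`: a Borel function which equals the approximate limit
of `φ` at every point outside `S_φ`. -/
structure IsLebesgueRepresentative {n : ℕ} (φ ψ : E n → ℝ) : Prop where
  measurable : Measurable ψ
  eq_approxLimit : ∀ x l, HasApproxLimit φ x l → ψ x = l

/-- The occupation measure of the path `X` on `[0,T]`, i.e. the image of Lebesgue measure on
`[0,T]` under `X`. -/
def occupationMeasure {n : ℕ} (T : ℝ) (X : ℝ → E n) : Measure (E n) :=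
  (volume.restrict (Set.Icc 0 T)).map X

/-- The a.e.-equivalence class `F` on `[0,T]` is the class of `t ↦ ψ(X_t)` for some Lebesgue
representative `ψ` of `φ`, that is, `F` is a composition `φ ∘ X`. -/
def IsComposition {n : ℕ} (φ : E n → ℝ) (T : ℝ) (X : ℝ → E n)
    (F : ℝ →ₘ[volume.restrict (Set.Icc 0 T)] ℝ) : Prop :=
  ∃ ψ : E n → ℝ, IsLebesgueRepresentative φ ψ ∧
    F =ᵐ[volume.restrict (Set.Icc 0 T)] fun t => ψ (X t)

end BVPath

end

noncomputable section

namespace BVPath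

variable {n : ℕ} {φ : E n → ℝ}

/-! ### The total variation measure: local finiteness and domination of each `D_i φ`. -/

namespace IsBVLoc

/-! Finiteness of the potential at one point `x` of `U` already forces an approximate limit at `x`.
On `B(x,r)` the kernel is at least `r^(-(n-1+s))`, so `‖Dφ‖(B(x,r)) ≤ K r^(n-1+s)`, where `K` is the
value of the potential. A Poincaré inequality bounds the mean oscillation of `φ` on `B(x,r)` by a
constant times `r^(1-n) ‖Dφ‖(B(x,4r))`, hence by `C r^s`. By Campanato's argument the averages over
dyadic balls then form a Cauchy sequence, and `φ` converges to their limit in mean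
(`exists_hasApproxLimit_of_potential_lt_top`).

Variability makes the potential finite at `X t` for almost every `t`, so `X t` lies outside `S_φ`
for almost every `t`. All four claims follow: Lebesgue representatives agree outside `S_φ`, and an
approximate limit is a limit of averages, so it is bounded by the essential supremum of `|φ|`.

The Poincaré inequality rests on the translation estimate `∫ |φ(y+h) - φ(y)| dy ≤ n |h| ‖Dφ‖`,
localized to balls (`setLIntegral_translate_sub_le`). It holds for mollifications by the fundamental
theorem of calculus and passes to `φ` by Fatou's lemma; averaging over `|h| < 2r` gives the
inequality. -/

theorem totalVariation_apply (hφ : IsBVLoc φ) {B : Set (E n)} (hB : MeasurableSet B) :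
    hφ.totalVariation B = preVariationFun hφ.gradNorm B := by
  rw [totalVariation, preVariation_apply, VectorMeasure.ennrealToMeasure_apply hB,
    ennrealPreVariation_apply]

theorem gradNorm_le_totalVariation (hφ : IsBVLoc φ) {B : Set (E n)} (hB : MeasurableSet B) :
    hφ.gradNorm B ≤ hφ.totalVariation B := by
  rcases B.eq_empty_or_nonempty with rfl | hne
  · simp [gradNorm_empty]
  rw [hφ.totalVariation_apply hB]
  have hne' : (⟨B, hB⟩ : Subtype (MeasurableSet (α := E n))) ≠ ⊥ := by
    intro h
    exact hne.ne_empty (congrArg Subtype.val h)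
  simpa using preVariation.sum_le hφ.gradNorm hB (Finpartition.indiscrete hne')

theorem gradNorm_le_sum (hφ : IsBVLoc φ) (B : Set (E n)) :
    hφ.gradNorm B ≤ (∑ i, (hφ.derivPos i + hφ.derivNeg i)) B := by
  unfold gradNorm
  split_ifs with hb
  · have hfin : ∀ i, hφ.derivPos i B ≠ ∞ ∧ hφ.derivNeg i B ≠ ∞ := fun i =>
      have := (hφ.isPartialDerivMeasure i).locallyFinite_pos
      have := (hφ.isPartialDerivMeasure i).locallyFinite_neg
      ⟨hb.measure_lt_top.ne, hb.measure_lt_top.ne⟩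
    have hsum : hφ.grad B = ∑ i, EuclideanSpace.single i (hφ.grad B i) := by
      ext j
      simp [Finset.sum_apply]
    rw [hsum, Measure.finsetSum_apply]
    refine (enorm_sum_le _ _).trans (Finset.sum_le_sum fun i _ => ?_)
    have h1 : ‖EuclideanSpace.single i (hφ.grad B i)‖ₑ = ‖hφ.grad B i‖ₑ := by
      rw [← ofReal_norm, ← ofReal_norm, PiLp.norm_single]
    rw [h1, Measure.add_apply]
    refine (enorm_sub_le (a := (hφ.derivPos i).real B) (b := (hφ.derivNeg i).real B)).trans ?_
    rw [Real.enorm_of_nonneg measureReal_nonneg, Real.enorm_of_nonneg measureReal_nonneg,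
      ofReal_measureReal (hfin i).1, ofReal_measureReal (hfin i).2]
  · exact zero_le

/-- A crude bound, since the two parts of `D_i φ` need not be mutually singular; it serves only to
make `‖Dφ‖` finite on bounded sets. -/
theorem totalVariation_le_sum (hφ : IsBVLoc φ) :
    hφ.totalVariation ≤ ∑ i, (hφ.derivPos i + hφ.derivNeg i) := by
  refine Measure.le_iff.2 fun B hB => ?_
  rw [hφ.totalVariation_apply hB, preVariationFun_apply _ hB]
  refine iSup_le fun P => ?_
  refine (Finset.sum_le_sum (f := fun p : Subtype (MeasurableSet (α := E n)) => hφ.gradNorm p)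
    fun p _ => hφ.gradNorm_le_sum p).trans ?_
  rw [← measure_biUnion_finset (f := fun p : Subtype (MeasurableSet (α := E n)) => (p : Set (E n)))
    (fun p hp q hq hpq => ?_) (fun p _ => p.2)]
  · exact measure_mono (Set.iUnion₂_subset fun p hp => P.le hp)
  · have := P.disjoint hp hq hpq
    rw [Function.onFun, id, id, disjoint_iff] at this
    exact Set.disjoint_iff_inter_eq_empty.2 (congrArg Subtype.val this)

theorem totalVariation_lt_top (hφ : IsBVLoc φ) {B : Set (E n)} (hB : Bornology.IsBounded B) :
    hφ.totalVariation B < ∞ := by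
  refine (hφ.totalVariation_le_sum B).trans_lt ?_
  rw [Measure.finsetSum_apply]
  refine ENNReal.sum_lt_top.2 fun i _ => ?_
  have := (hφ.isPartialDerivMeasure i).locallyFinite_pos
  have := (hφ.isPartialDerivMeasure i).locallyFinite_neg
  exact ENNReal.add_lt_top.2 ⟨hB.measure_lt_top, hB.measure_lt_top⟩

instance isLocallyFiniteMeasure_totalVariation (hφ : IsBVLoc φ) :
    IsLocallyFiniteMeasure hφ.totalVariation :=
  ⟨fun x => ⟨Metric.ball x 1, Metric.ball_mem_nhds x one_pos,
    hφ.totalVariation_lt_top Metric.isBounded_ball⟩⟩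

theorem enorm_derivPos_sub_derivNeg_le (hφ : IsBVLoc φ) (i : Fin n) {B : Set (E n)}
    (hB : MeasurableSet B) (hb : Bornology.IsBounded B) :
    ‖(hφ.derivPos i).real B - (hφ.derivNeg i).real B‖ₑ ≤ hφ.totalVariation B := by
  refine le_trans ?_ (hφ.gradNorm_le_totalVariation hB)
  rw [gradNorm, if_pos hb, ← ofReal_norm, ← ofReal_norm]
  exact ENNReal.ofReal_le_ofReal (PiLp.norm_apply_le (hφ.grad B) i)

/-- If `|μ₁ - μ₂| ≤ ν` on bounded sets, then `μ₁ ≤ μ₂ + ν` when integrating boundedly supported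
nonnegative functions. -/
theorem lintegral_le_lintegral_add {μ₁ μ₂ ν : Measure (E n)} [IsLocallyFiniteMeasure μ₁]
    [IsLocallyFiniteMeasure μ₂]
    (h : ∀ B, MeasurableSet B → Bornology.IsBounded B → ‖μ₁.real B - μ₂.real B‖ₑ ≤ ν B)
    {f : E n → ℝ≥0∞} (hf : Bornology.IsBounded (Function.support f)) :
    ∫⁻ x, f x ∂μ₁ ≤ ∫⁻ x, f x ∂μ₂ + ∫⁻ x, f x ∂ν := by
  obtain ⟨R, hR⟩ := hf.subset_ball 0
  -- The hypothesis concerns bounded sets only, so the measures are compared inside a ball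
  -- containing the support.
  have key : μ₁.restrict (Metric.ball 0 R) ≤ (μ₂ + ν).restrict (Metric.ball 0 R) := by
    refine Measure.le_iff.2 fun B hB => ?_
    rw [Measure.restrict_apply hB, Measure.restrict_apply hB, Measure.add_apply]
    set C := B ∩ Metric.ball 0 R
    have hb : Bornology.IsBounded C := Metric.isBounded_ball.subset Set.inter_subset_right
    have h1 := h C (hB.inter measurableSet_ball) hb
    rw [← ofReal_measureReal (μ := μ₁) hb.measure_lt_top.ne,
      ← ofReal_measureReal (μ := μ₂) hb.measure_lt_top.ne]
    refine le_trans ?_ (add_le_add_right h1 _)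
    rw [← ofReal_norm, ← ENNReal.ofReal_add measureReal_nonneg (norm_nonneg _)]
    refine ENNReal.ofReal_le_ofReal ?_
    have := le_abs_self (μ₁.real C - μ₂.real C)
    rw [Real.norm_eq_abs]
    linarith
  rw [← lintegral_add_measure, ← setLIntegral_eq_of_support_subset hR,
    ← setLIntegral_eq_of_support_subset (μ := μ₂ + ν) hR]
  exact lintegral_mono' key le_rfl

/-- Apply the one-sided comparison twice, with the roles of the two parts of `D_i φ` exchanged. -/
theorem enorm_integral_sub_le (hφ : IsBVLoc φ) (i : Fin n) {ψ : E n → ℝ} (hψ : Continuous ψ)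
    (hc : HasCompactSupport ψ) (h0 : ∀ x, 0 ≤ ψ x) :
    ‖∫ x, ψ x ∂(hφ.derivPos i) - ∫ x, ψ x ∂(hφ.derivNeg i)‖ₑ
      ≤ ∫⁻ x, ENNReal.ofReal (ψ x) ∂hφ.totalVariation := by
  have := (hφ.isPartialDerivMeasure i).locallyFinite_pos
  have := (hφ.isPartialDerivMeasure i).locallyFinite_neg
  have hsupp : Bornology.IsBounded (Function.support fun x => ENNReal.ofReal (ψ x)) := by
    refine hc.isBounded.subset (subset_trans (fun x hx => ?_) (subset_tsupport ψ))
    intro h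
    simp [h] at hx
  have e1 := ofReal_integral_eq_lintegral_ofReal
    (hψ.integrable_of_hasCompactSupport (μ := hφ.derivPos i) hc) (ae_of_all _ h0)
  have e2 := ofReal_integral_eq_lintegral_ofReal
    (hψ.integrable_of_hasCompactSupport (μ := hφ.derivNeg i) hc) (ae_of_all _ h0)
  have l1 := lintegral_le_lintegral_add (ν := hφ.totalVariation)
    (fun B => hφ.enorm_derivPos_sub_derivNeg_le i (B := B)) hsupp
  have l2 := lintegral_le_lintegral_add (ν := hφ.totalVariation) (μ₁ := hφ.derivNeg i)
    (μ₂ := hφ.derivPos i)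
    (fun B hB hb => by
      rw [enorm_sub_rev]; exact hφ.enorm_derivPos_sub_derivNeg_le i (B := B) hB hb) hsupp
  rw [← e1, ← e2] at l1 l2
  set a := ∫ x, ψ x ∂(hφ.derivPos i)
  set b := ∫ x, ψ x ∂(hφ.derivNeg i)
  have ha : 0 ≤ a := integral_nonneg h0
  have hb : 0 ≤ b := integral_nonneg h0
  rw [← ofReal_norm, Real.norm_eq_abs]
  rcases le_total a b with hab | hab
  · rw [abs_of_nonpos (by linarith), neg_sub, ENNReal.ofReal_sub _ ha]
    exact tsub_le_iff_left.2 l2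
  · rw [abs_of_nonneg (by linarith), ENNReal.ofReal_sub _ hb]
    exact tsub_le_iff_left.2 l1

end IsBVLoc

/-! ### Mollification, the translation estimate and the Poincaré inequality. -/

open ContinuousLinearMap in
/-- The mollification of `φ` by the normalized bump function `η`. -/
def mollify (η : ContDiffBump (0 : E n)) (φ : E n → ℝ) : E n → ℝ :=
  convolution (η.normed volume) φ (lsmul ℝ ℝ) volume

theorem contDiff_mollify (η : ContDiffBump (0 : E n)) (hφ : LocallyIntegrable φ volume) :
    ContDiff ℝ 1 (mollify η φ) :=
  η.hasCompactSupport_normed.contDiff_convolution_left _ η.contDiff_normed hφ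

theorem fderiv_mollify_apply (η : ContDiffBump (0 : E n)) (hφ : LocallyIntegrable φ volume)
    (y v : E n) :
    fderiv ℝ (mollify η φ) y v = ∫ z, φ z * fderiv ℝ (η.normed volume) (y - z) v := by
  have hc : HasCompactSupport (η.normed (volume : Measure (E n))) := η.hasCompactSupport_normed
  have hη : ContDiff ℝ 1 (η.normed (volume : Measure (E n))) := η.contDiff_normed
  have h := hc.hasFDerivAt_convolution_left (ContinuousLinearMap.lsmul ℝ ℝ) hη hφ y
  have hint : ConvolutionExistsAt (fderiv ℝ (η.normed (volume : Measure (E n)))) φ y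
      ((ContinuousLinearMap.lsmul ℝ ℝ).precompL (E n)) volume :=
    (hc.fderiv ℝ).convolutionExists_left _ (hη.continuous_fderiv one_ne_zero) hφ y
  rw [mollify, h.fderiv, convolution_def, ContinuousLinearMap.integral_apply hint,
    ← integral_sub_left_eq_self _ volume y]
  refine integral_congr_ae (ae_of_all _ fun z => ?_)
  simp [ContinuousLinearMap.precompL_apply, mul_comm]

namespace IsBVLoc

/-- Test the distributional derivative with `z ↦ η(y - z)`; the sign from the chain rule cancels the
sign from integration by parts. -/
theorem fderiv_mollify_single (hφ : IsBVLoc φ) (η : ContDiffBump (0 : E n)) (y : E n)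
    (i : Fin n) :
    fderiv ℝ (mollify η φ) y (EuclideanSpace.single i 1) =
      ∫ z, η.normed volume (y - z) ∂(hφ.derivPos i) -
        ∫ z, η.normed volume (y - z) ∂(hφ.derivNeg i) := by
  have hη : ContDiff ℝ (⊤ : ℕ∞) (η.normed (volume : Measure (E n))) := η.contDiff_normed
  have hψ : ContDiff ℝ (⊤ : ℕ∞) fun z => η.normed (volume : Measure (E n)) (y - z) :=
    hη.comp (contDiff_const.sub contDiff_id)
  have hc : HasCompactSupport fun z => η.normed (volume : Measure (E n)) (y - z) :=
    η.hasCompactSupport_normed.comp_homeomorph (Homeomorph.subLeft y)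
  have h := (hφ.isPartialDerivMeasure i).integral_eq _ hψ hc
  rw [fderiv_mollify_apply η hφ.locallyIntegrable, ← neg_inj, ← h, ← integral_neg]
  refine integral_congr_ae (ae_of_all _ fun z => ?_)
  have hd : HasFDerivAt (fun z => η.normed (volume : Measure (E n)) (y - z))
      ((fderiv ℝ (η.normed volume) (y - z)).comp (-ContinuousLinearMap.id ℝ (E n))) z :=
    ((hη.differentiable (by simp)) (y - z)).hasFDerivAt.comp z
      ((hasFDerivAt_id z).const_sub y)
  simp [hd.fderiv]

theorem enorm_fderiv_mollify_le (hφ : IsBVLoc φ) (η : ContDiffBump (0 : E n)) (y v : E n) :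
    ‖fderiv ℝ (mollify η φ) y v‖ₑ ≤
      n * ‖v‖ₑ * ∫⁻ z, ENNReal.ofReal (η.normed volume (y - z)) ∂hφ.totalVariation := by
  have hsum : v = ∑ i, v i • EuclideanSpace.single i (1 : ℝ) := by
    ext j
    simp [Finset.sum_apply, Pi.single_apply]
  conv_lhs => rw [hsum]
  rw [map_sum, mul_assoc]
  refine (enorm_sum_le _ _).trans ?_
  refine (Finset.sum_le_card_nsmul _ _ (‖v‖ₑ *
    ∫⁻ z, ENNReal.ofReal (η.normed volume (y - z)) ∂hφ.totalVariation) fun i _ => ?_).trans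
    (by simp)
  rw [map_smul, enorm_smul]
  gcongr
  · rw [← ofReal_norm, ← ofReal_norm]
    exact ENNReal.ofReal_le_ofReal (PiLp.norm_apply_le v i)
  · rw [hφ.fderiv_mollify_single]
    exact hφ.enorm_integral_sub_le i (η.continuous_normed.comp (continuous_const.sub continuous_id))
      (η.hasCompactSupport_normed.comp_homeomorph (Homeomorph.subLeft y))
      fun z => η.nonneg_normed _

/-- By Tonelli: for fixed `z` the kernel has integral at most `1` in `y`, and it vanishes for `y` in
`B(x,r)` unless `z` lies in the enlarged ball. -/
theorem setLIntegral_lintegral_normed_le (hφ : IsBVLoc φ) (η : ContDiffBump (0 : E n))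
    (x w : E n) (r : ℝ) :
    ∫⁻ y in Metric.ball x r, ∫⁻ z, ENNReal.ofReal (η.normed volume (y + w - z))
      ∂hφ.totalVariation ≤ hφ.totalVariation (Metric.ball x (r + ‖w‖ + η.rOut)) := by
  have hmeas : Measurable fun p : E n × E n =>
      ENNReal.ofReal (η.normed volume (p.1 + w - p.2)) := by
    have : Continuous (η.normed (volume : Measure (E n))) := η.continuous_normed
    fun_prop
  rw [lintegral_lintegral_swap hmeas.aemeasurable]
  rw [← lintegral_indicator_one measurableSet_ball]
  refine lintegral_mono fun z => ?_
  by_cases hz : z ∈ Metric.ball x (r + ‖w‖ + η.rOut)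
  · rw [Set.indicator_of_mem hz, Pi.one_apply]
    refine (lintegral_mono' Measure.restrict_le_self le_rfl).trans ?_
    have h1 : (fun y => ENNReal.ofReal (η.normed (volume : Measure (E n)) (y + w - z))) =
        fun y => (fun u => ENNReal.ofReal (η.normed volume u)) (y + (w - z)) := by
      ext y; simp [add_sub_assoc]
    rw [h1, lintegral_add_right_eq_self (μ := volume)
      (fun u => ENNReal.ofReal (η.normed (volume : Measure (E n)) u)),
      ← ofReal_integral_eq_lintegral_ofReal η.integrable_normed
        (ae_of_all _ η.nonneg_normed), η.integral_normed]
    simp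
  · rw [Set.indicator_of_notMem hz, nonpos_iff_eq_zero,
      setLIntegral_congr_fun (g := 0) measurableSet_ball]
    · simp
    intro y hy
    have : η.normed (volume : Measure (E n)) (y + w - z) = 0 := by
      rw [← Function.notMem_support, η.support_normed_eq, Metric.mem_ball, dist_zero_right]
      rw [Metric.mem_ball, dist_eq_norm] at hz hy
      intro h
      apply hz
      calc ‖z - x‖ = ‖(y - x) + w - (y + w - z)‖ := by congr 1; abel
        _ ≤ ‖y - x‖ + ‖w‖ + ‖y + w - z‖ :=
          (norm_sub_le _ _).trans (add_le_add_left (norm_add_le _ _) _)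
        _ < _ := by linarith
    simp [this]

/-- Integrate the derivative along the segment from `y` to `y + h`, exchange the integrals, and use
the previous bound with shift `t • h` for each `t`. -/
theorem setLIntegral_mollify_sub_le (hφ : IsBVLoc φ) (η : ContDiffBump (0 : E n))
    (x h : E n) (r : ℝ) :
    ∫⁻ y in Metric.ball x r, ‖mollify η φ (y + h) - mollify η φ y‖ₑ ≤
      n * ‖h‖ₑ * hφ.totalVariation (Metric.ball x (r + ‖h‖ + η.rOut)) := by
  have hf := contDiff_mollify η hφ.locallyIntegrable
  have hf' := hf.continuous_fderiv one_ne_zero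
  have hcont : Continuous (η.normed (volume : Measure (E n))) := η.continuous_normed
  have hftc : ∀ y, ‖mollify η φ (y + h) - mollify η φ y‖ₑ ≤
      ∫⁻ t in Set.Ioc (0 : ℝ) 1, n * ‖h‖ₑ * ∫⁻ z, ENNReal.ofReal
        (η.normed volume (y + t • h - z)) ∂hφ.totalVariation := by
    intro y
    have hd : ∀ t ∈ Set.uIcc (0 : ℝ) 1, HasDerivAt (fun t : ℝ => mollify η φ (y + t • h))
        (fderiv ℝ (mollify η φ) (y + t • h) h) t := fun t _ =>
      ((hf.differentiable one_ne_zero) _).hasFDerivAt.comp_hasDerivAt t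
        (by simpa using ((hasDerivAt_id t).smul_const h).const_add y)
    have e := intervalIntegral.integral_eq_sub_of_hasDerivAt hd
      (Continuous.intervalIntegrable (by fun_prop) _ _)
    simp only [one_smul, zero_smul, add_zero] at e
    rw [← e, intervalIntegral.integral_of_le zero_le_one]
    exact (enorm_integral_le_lintegral_enorm _).trans
      (lintegral_mono fun t => hφ.enorm_fderiv_mollify_le η _ _)
  have hmeas : Measurable fun p : (E n × ℝ) × E n => ENNReal.ofReal
      (η.normed volume (p.1.1 + p.1.2 • h - p.2)) := by fun_prop
  refine (lintegral_mono hftc).trans ?_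
  rw [lintegral_lintegral_swap (hmeas.lintegral_prod_right'.const_mul _).aemeasurable]
  have hbd : ∀ t ∈ Set.Ioc (0 : ℝ) 1, ∫⁻ y in Metric.ball x r, n * ‖h‖ₑ *
      ∫⁻ z, ENNReal.ofReal (η.normed volume (y + t • h - z)) ∂hφ.totalVariation ≤
      n * ‖h‖ₑ * hφ.totalVariation (Metric.ball x (r + ‖h‖ + η.rOut)) := by
    intro t ht
    rw [lintegral_const_mul' _ _ (ENNReal.mul_ne_top (by simp) (by simp))]
    gcongr
    refine (hφ.setLIntegral_lintegral_normed_le η x (t • h) r).trans (measure_mono ?_)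
    refine Metric.ball_subset_ball ?_
    rw [norm_smul, Real.norm_of_nonneg ht.1.le]
    have := mul_le_of_le_one_left (norm_nonneg h) ht.2
    linarith
  refine (setLIntegral_mono' measurableSet_Ioc hbd).trans ?_
  simp

/-- The translation estimate for functions of locally bounded variation. -/
theorem setLIntegral_translate_sub_le (hφ : IsBVLoc φ) (x h : E n) (r : ℝ) {δ : ℝ} (hδ : 0 < δ) :
    ∫⁻ y in Metric.ball x r, ‖φ (y + h) - φ y‖ₑ ≤
      n * ‖h‖ₑ * hφ.totalVariation (Metric.ball x (r + ‖h‖ + δ)) := by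
  -- The outer radii tend to `0` but never exceed the margin `δ`; the fixed ratio `2` to the inner
  -- radii is what almost everywhere convergence of the mollifications requires.
  let η : ℕ → ContDiffBump (0 : E n) := fun k =>
    { rIn := δ / (k + 1) / 2
      rOut := δ / (k + 1)
      rIn_pos := by positivity
      rIn_lt_rOut := half_lt_self (by positivity) }
  have hη : Tendsto (fun k => (η k).rOut) atTop (𝓝 0) := by
    simpa [η, Function.comp_def] using
      (tendsto_const_div_atTop_nhds_zero_nat δ).comp (tendsto_add_atTop_nat 1)
  have hlim : ∀ᵐ y, Tendsto (fun k => mollify (η k) φ y) atTop (𝓝 (φ y)) :=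
    ContDiffBump.ae_convolution_tendsto_right_of_locallyIntegrable (K := 2) hη
      (Eventually.of_forall fun k => by simp only [η]; linarith) hφ.locallyIntegrable
  have hlim' : ∀ᵐ y, Tendsto (fun k => mollify (η k) φ (y + h)) atTop (𝓝 (φ (y + h))) :=
    (measurePreserving_add_right volume h).quasiMeasurePreserving.ae hlim
  have hcont : ∀ k, Continuous (mollify (η k) φ) := fun k =>
    (contDiff_mollify (η k) hφ.locallyIntegrable).continuous
  calc ∫⁻ y in Metric.ball x r, ‖φ (y + h) - φ y‖ₑ
      = ∫⁻ y in Metric.ball x r, liminf (fun k =>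
          ‖mollify (η k) φ (y + h) - mollify (η k) φ y‖ₑ) atTop := by
        refine lintegral_congr_ae (ae_restrict_of_ae ?_)
        filter_upwards [hlim, hlim'] with y h1 h2
        exact ((h2.sub h1).enorm.liminf_eq).symm
    _ ≤ liminf (fun k => ∫⁻ y in Metric.ball x r,
          ‖mollify (η k) φ (y + h) - mollify (η k) φ y‖ₑ) atTop := by
        refine lintegral_liminf_le fun k => ?_
        have := hcont k
        fun_prop
    _ ≤ _ := by
        refine liminf_le_of_frequently_le' (Frequently.of_forall fun k => ?_)
        refine (hφ.setLIntegral_mollify_sub_le (η k) x h r).trans ?_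
        gcongr
        simp only [η]
        exact div_le_self hδ.le (by simp)

/-- A weak Poincaré inequality for functions of locally bounded variation. -/
theorem lintegral_lintegral_sub_le (hφ : IsBVLoc φ) (x : E n) {r : ℝ} (hr : 0 < r) :
    ∫⁻ y in Metric.ball x r, ∫⁻ w in Metric.ball x r, ‖φ w - φ y‖ₑ ≤
      volume (Metric.ball (0 : E n) (2 * r)) *
        (n * ENNReal.ofReal (2 * r) * hφ.totalVariation (Metric.ball x (4 * r))) := by
  -- `φ` is only almost everywhere measurable, so composition with addition needs addition to be
  -- quasi measure preserving.
  have hm : AEMeasurable (fun p : E n × E n => ‖φ (p.1 + p.2) - φ p.1‖ₑ)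
      ((volume.restrict (Metric.ball x r)).prod
        (volume.restrict (Metric.ball (0 : E n) (2 * r)))) := by
    have hφm := hφ.locallyIntegrable.aestronglyMeasurable
    have h1 : AEStronglyMeasurable (fun p : E n × E n => φ (p.1 + p.2))
        (volume.prod volume) :=
      hφm.comp_quasiMeasurePreserving (quasiMeasurePreserving_add volume volume)
    have h2 : AEStronglyMeasurable (fun p : E n × E n => φ p.1)
        (volume.prod volume) := hφm.comp_fst
    rw [Measure.prod_restrict]
    exact (h1.sub h2).enorm.restrict
  calc ∫⁻ y in Metric.ball x r, ∫⁻ w in Metric.ball x r, ‖φ w - φ y‖ₑ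
      ≤ ∫⁻ y in Metric.ball x r, ∫⁻ h in Metric.ball (0 : E n) (2 * r), ‖φ (y + h) - φ y‖ₑ := by
        refine setLIntegral_mono' measurableSet_ball fun y hy => ?_
        refine le_trans ?_ ((measurePreserving_add_left volume y).setLIntegral_comp_emb
          (MeasurableEquiv.addLeft y).measurableEmbedding (fun w => ‖φ w - φ y‖ₑ)
          (Metric.ball (0 : E n) (2 * r))).ge
        refine lintegral_mono_set fun w hw => ⟨w - y, ?_, by simp⟩
        rw [mem_ball_zero_iff, ← dist_eq_norm]
        have := dist_triangle_right w y x
        rw [Metric.mem_ball] at hw hy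
        linarith
    _ = ∫⁻ h in Metric.ball (0 : E n) (2 * r), ∫⁻ y in Metric.ball x r, ‖φ (y + h) - φ y‖ₑ :=
        lintegral_lintegral_swap hm
    _ ≤ ∫⁻ h in Metric.ball (0 : E n) (2 * r),
          n * ENNReal.ofReal (2 * r) * hφ.totalVariation (Metric.ball x (4 * r)) := by
        refine setLIntegral_mono' measurableSet_ball fun h hh => ?_
        rw [mem_ball_zero_iff] at hh
        -- The margin is `δ = r`, so the radius is `r + ‖h‖ + r ≤ 4 * r`.
        refine (hφ.setLIntegral_translate_sub_le x h r hr).trans ?_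
        gcongr
        · rw [← ofReal_norm]
          exact ENNReal.ofReal_le_ofReal hh.le
        · linarith
    _ = _ := by simp [mul_comm]

end IsBVLoc

/-! ### Averages over balls, approximate limits and Lebesgue representatives. -/

theorem volume_ball_two_mul (x y : E n) {r : ℝ} :
    volume (Metric.ball x (2 * r)) = 2 ^ n * volume (Metric.ball y r) := by
  rw [Measure.addHaar_ball_mul_of_pos volume x two_pos r, finrank_euclideanSpace_fin,
    Measure.addHaar_ball_center volume y r, ENNReal.ofReal_pow (by norm_num)]
  simp

theorem integrableOn_ball (hφ : LocallyIntegrable φ volume) (x : E n) (r : ℝ) :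
    IntegrableOn φ (Metric.ball x r) volume :=
  (hφ.integrableOn_isCompact (isCompact_closedBall x r)).mono_set Metric.ball_subset_closedBall

theorem integrableOn_ball_abs_sub (hφ : LocallyIntegrable φ volume) (x : E n) (r c : ℝ) :
    IntegrableOn (fun y => |φ y - c|) (Metric.ball x r) volume :=
  ((integrableOn_ball hφ x r).sub (integrableOn_const measure_ball_lt_top.ne)).abs

theorem volume_real_ball_pos (x : E n) {r : ℝ} (hr : 0 < r) :
    0 < volume.real (Metric.ball x r) :=
  ENNReal.toReal_pos (Metric.measure_ball_pos volume x hr).ne' measure_ball_lt_top.ne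

theorem abs_setAverage_sub_le (hφ : LocallyIntegrable φ volume) (x : E n) {r : ℝ} (hr : 0 < r)
    (c : ℝ) :
    |(⨍ y in Metric.ball x r, φ y) - c| ≤ ⨍ y in Metric.ball x r, |φ y - c| := by
  have hV := volume_real_ball_pos x hr
  rw [setAverage_eq, setAverage_eq, smul_eq_mul, smul_eq_mul]
  have h1 : ∫ y in Metric.ball x r, (φ y - c) =
      (∫ y in Metric.ball x r, φ y) - volume.real (Metric.ball x r) * c := by
    rw [integral_sub (integrableOn_ball hφ x r) (integrableOn_const measure_ball_lt_top.ne)]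
    simp
  have h2 : (volume.real (Metric.ball x r))⁻¹ * (∫ y in Metric.ball x r, φ y) - c =
      (volume.real (Metric.ball x r))⁻¹ * ∫ y in Metric.ball x r, (φ y - c) := by
    rw [h1]; field_simp
  rw [h2, abs_mul, abs_of_pos (inv_pos.2 hV)]
  gcongr
  exact abs_integral_le_integral_abs

/-- Volume doubling: this is the price of comparing consecutive dyadic radii, or an arbitrary radius
with a dyadic one. -/
theorem setAverage_abs_sub_le_of_le_two_mul (hφ : LocallyIntegrable φ volume) (x : E n)
    {r ρ : ℝ} (hr : 0 < r) (h1 : r ≤ ρ) (h2 : ρ ≤ 2 * r) (c : ℝ) :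
    ⨍ y in Metric.ball x r, |φ y - c| ≤ 2 ^ n * ⨍ y in Metric.ball x ρ, |φ y - c| := by
  have hV := volume_real_ball_pos x hr
  have hW := volume_real_ball_pos x (hr.trans_le h1)
  have hVW : volume.real (Metric.ball x ρ) ≤ 2 ^ n * volume.real (Metric.ball x r) := by
    calc volume.real (Metric.ball x ρ) ≤ volume.real (Metric.ball x (2 * r)) :=
          measureReal_mono (Metric.ball_subset_ball h2) measure_ball_lt_top.ne
      _ = _ := by simp [Measure.real, volume_ball_two_mul x x]
  have hI : ∫ y in Metric.ball x r, |φ y - c| ≤ ∫ y in Metric.ball x ρ, |φ y - c| :=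
    setIntegral_mono_set (integrableOn_ball_abs_sub hφ x ρ c) (ae_of_all _ fun _ => abs_nonneg _)
      (Metric.ball_subset_ball h1).eventuallyLE
  rw [setAverage_eq, setAverage_eq, smul_eq_mul, smul_eq_mul, ← mul_assoc]
  refine mul_le_mul ?_ hI (integral_nonneg fun _ => abs_nonneg _) (by positivity)
  rw [inv_le_iff_one_le_mul₀ hV]
  field_simp
  linarith

theorem setAverage_abs_sub_le_add (hφ : LocallyIntegrable φ volume) (x : E n) {r : ℝ}
    (hr : 0 < r) (a b : ℝ) :
    ⨍ y in Metric.ball x r, |φ y - b| ≤ (⨍ y in Metric.ball x r, |φ y - a|) + |a - b| := by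
  have hV := volume_real_ball_pos x hr
  have hc : IntegrableOn (fun _ => |a - b|) (Metric.ball x r) (volume : Measure (E n)) :=
    integrableOn_const measure_ball_lt_top.ne
  have hI : ∫ y in Metric.ball x r, |φ y - b| ≤
      (∫ y in Metric.ball x r, |φ y - a|) + volume.real (Metric.ball x r) * |a - b| := by
    have := integral_mono (integrableOn_ball_abs_sub hφ x r b)
      ((integrableOn_ball_abs_sub hφ x r a).add hc) fun y => abs_sub_le (φ y) a b
    rw [integral_add' (integrableOn_ball_abs_sub hφ x r a) hc] at this
    simpa using this
  rw [setAverage_eq, setAverage_eq, smul_eq_mul, smul_eq_mul]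
  refine (mul_le_mul_of_nonneg_left hI (inv_pos.2 hV).le).trans (le_of_eq ?_)
  field_simp

/-- A Campanato type criterion: power decay of the mean oscillation at a point yields an
approximate limit there. -/
theorem exists_hasApproxLimit_of_oscillation_le (hφ : LocallyIntegrable φ volume) {x : E n}
    {R C s : ℝ} (hR : 0 < R) (hs : 0 < s)
    (h : ∀ r, 0 < r → r ≤ R →
      ⨍ y in Metric.ball x r, |φ y - ⨍ w in Metric.ball x r, φ w| ≤ C * r ^ s) :
    ∃ l, HasApproxLimit φ x l := by
  set m : ℝ → ℝ := fun r => ⨍ w in Metric.ball x r, φ w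
  set ρ : ℕ → ℝ := fun k => R * (1 / 2) ^ k with hρ
  set q : ℝ := (1 / 2) ^ s with hq
  have hq0 : 0 < q := by positivity
  have hq1 : q < 1 := Real.rpow_lt_one (by norm_num) (by norm_num) hs
  have hρ0 : ∀ k, 0 < ρ k := fun k => by positivity
  have hρR : ∀ k, ρ k ≤ R := fun k =>
    mul_le_of_le_one_right hR.le (pow_le_one₀ (by norm_num) (by norm_num))
  have hpow : ∀ k : ℕ, (((1 : ℝ) / 2) ^ k) ^ s = q ^ k := fun k => by
    rw [hq, ← Real.rpow_natCast, ← Real.rpow_natCast, ← Real.rpow_mul (by norm_num),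
      ← Real.rpow_mul (by norm_num), mul_comm]
  have hρs : ∀ k, ρ k ^ s = R ^ s * q ^ k := fun k => by
    rw [← hpow, ← Real.mul_rpow hR.le (by positivity)]
  have hosc : ∀ k, ⨍ y in Metric.ball x (ρ k), |φ y - m (ρ k)| ≤ C * R ^ s * q ^ k := fun k => by
    have := h (ρ k) (hρ0 k) (hρR k)
    rwa [hρs, ← mul_assoc] at this
  have hstep : ∀ k, dist (m (ρ k)) (m (ρ (k + 1))) ≤ 2 ^ n * (C * R ^ s) * q ^ k := by
    intro k
    rw [dist_comm, Real.dist_eq]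
    refine (abs_setAverage_sub_le hφ x (hρ0 (k + 1)) _).trans ?_
    refine (setAverage_abs_sub_le_of_le_two_mul hφ x (hρ0 (k + 1)) (ρ := ρ k) ?_ ?_ _).trans ?_
    · simp only [hρ, pow_succ]
      have := hρ0 k
      simp only [hρ] at this
      linarith
    · simp only [hρ, pow_succ]
      linarith
    · rw [mul_assoc]
      exact mul_le_mul_of_nonneg_left (hosc k) (by positivity)
  obtain ⟨l, hl⟩ := cauchySeq_tendsto_of_complete (cauchySeq_of_le_geometric q _ hq1 hstep)
  have hdist := dist_le_of_le_geometric_of_tendsto q _ hq1 hstep hl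
  refine ⟨l, ?_⟩
  set M : ℝ := 2 ^ n * (C * R ^ s + 2 ^ n * (C * R ^ s) / (1 - q)) with hM
  have hk : ∀ k, 2 ^ n * ⨍ y in Metric.ball x (ρ k), |φ y - l| ≤ M * q ^ k := by
    intro k
    rw [hM, mul_assoc]
    refine mul_le_mul_of_nonneg_left ?_ (by positivity)
    refine (setAverage_abs_sub_le_add hφ x (hρ0 k) (m (ρ k)) l).trans ?_
    have h1 := hosc k
    have h2 := hdist k
    rw [Real.dist_eq] at h2
    rw [add_mul, div_mul_eq_mul_div]
    exact add_le_add h1 h2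
  -- No sign of `C` is assumed; that of `M` is read off from the case `k = 0`, where `M` bounds a
  -- nonnegative quantity.
  have hM0 : 0 ≤ M := by
    have := hk 0
    rw [pow_zero, mul_one] at this
    refine le_trans ?_ this
    rw [setAverage_eq]
    exact mul_nonneg (by positivity) (mul_nonneg (inv_nonneg.2 measureReal_nonneg)
      (integral_nonneg fun _ => abs_nonneg _))
  have hbound : ∀ r, 0 < r → r ≤ R →
      ⨍ y in Metric.ball x r, |φ y - l| ≤ M * (2 * r / R) ^ s := by
    intro r hr hrR
    -- Choose `k` with `ρ k / 2 < r ≤ ρ k`.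
    obtain ⟨k, hk1, hk2⟩ := exists_nat_pow_near_of_lt_one (div_pos hr hR) ((div_le_one hR).2 hrR)
      (one_half_pos (α := ℝ)) one_half_lt_one
    rw [lt_div_iff₀ hR, pow_succ] at hk1
    rw [div_le_iff₀ hR] at hk2
    refine (setAverage_abs_sub_le_of_le_two_mul hφ x hr (ρ := ρ k) (by simp only [hρ]; linarith)
      (by simp only [hρ]; linarith) l).trans ((hk k).trans ?_)
    refine mul_le_mul_of_nonneg_left ?_ hM0
    rw [← hpow]
    refine Real.rpow_le_rpow (by positivity) ?_ hs.le
    rw [le_div_iff₀ hR]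
    linarith
  have hlim : Tendsto (fun r : ℝ => M * (2 * r / R) ^ s) (𝓝[>] 0) (𝓝 0) := by
    have hc : Continuous fun r : ℝ => M * (2 * r / R) ^ s :=
      continuous_const.mul (Continuous.rpow_const (by fun_prop) fun _ => Or.inr hs.le)
    have := (hc.tendsto 0).mono_left (nhdsWithin_le_nhds (s := Set.Ioi 0))
    simpa [Real.zero_rpow hs.ne'] using this
  refine squeeze_zero' (Eventually.of_forall fun r => ?_) ?_ hlim
  · rw [setAverage_eq]
    exact mul_nonneg (inv_nonneg.2 measureReal_nonneg) (integral_nonneg fun _ => abs_nonneg _)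
  · filter_upwards [Ioc_mem_nhdsGT hR] with r hr using hbound r hr.1 hr.2

theorem HasApproxLimit.tendsto_setAverage (hφ : LocallyIntegrable φ volume) {x : E n} {l : ℝ}
    (h : HasApproxLimit φ x l) :
    Tendsto (fun r : ℝ => ⨍ y in Metric.ball x r, φ y) (𝓝[>] 0) (𝓝 l) := by
  rw [tendsto_iff_dist_tendsto_zero]
  refine squeeze_zero' (Eventually.of_forall fun r => dist_nonneg) ?_ h
  filter_upwards [self_mem_nhdsWithin] with r hr using abs_setAverage_sub_le hφ x hr l

theorem HasApproxLimit.abs_le (hφ : LocallyIntegrable φ volume) {x : E n} {l M : ℝ}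
    (h : HasApproxLimit φ x l) (hM : ∀ᵐ y, |φ y| ≤ M) : |l| ≤ M := by
  refine le_of_tendsto (h.tendsto_setAverage hφ).abs ?_
  filter_upwards [self_mem_nhdsWithin] with r hr
  have hV := volume_real_ball_pos x hr
  rw [setAverage_eq, smul_eq_mul, abs_mul, abs_of_pos (inv_pos.2 hV), inv_mul_le_iff₀ hV, mul_comm]
  exact norm_setIntegral_le_of_norm_le_const_ae (f := φ) measure_ball_lt_top
    (ae_restrict_of_ae hM)

theorem measurable_setAverage_ball (hφ : LocallyIntegrable φ volume) (r : ℝ) :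
    Measurable fun x : E n => ⨍ y in Metric.ball x r, φ y := by
  have hφm := hφ.aestronglyMeasurable
  have hg := hφm.stronglyMeasurable_mk
  set g := hφm.mk φ
  -- The volume of the ball does not depend on its centre, and with a measurable version `g` of `φ`
  -- the integrand is jointly measurable in `(x, y)`.
  have h1 : (fun x : E n => ⨍ y in Metric.ball x r, φ y) = fun x =>
      (volume.real (Metric.ball (0 : E n) r))⁻¹ *
        ∫ y, {p : E n × E n | dist p.2 p.1 < r}.indicator (fun p => g p.2) (x, y) := by
    ext x
    rw [setAverage_eq, smul_eq_mul, Measure.addHaar_real_ball_center,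
      ← integral_indicator measurableSet_ball]
    congr 1
    refine integral_congr_ae ?_
    filter_upwards [hφm.ae_eq_mk] with y hy
    simp [Set.indicator, hy, g]
  rw [h1]
  refine Measurable.const_mul ?_ _
  refine (StronglyMeasurable.integral_prod_right
    (f := fun x y => {p : E n × E n | dist p.2 p.1 < r}.indicator (fun p => g p.2) (x, y))
    ?_).measurable
  exact (hg.comp_measurable measurable_snd).indicator
    (measurableSet_lt (by fun_prop) measurable_const)

theorem exists_isLebesgueRepresentative (hφ : LocallyIntegrable φ volume) :
    ∃ ψ : E n → ℝ, IsLebesgueRepresentative φ ψ := by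
  -- Outside `S_φ` the averages converge, so any default value of the real `limsup` along an
  -- unbounded sequence can occur only on `S_φ`.
  refine ⟨fun x => limsup (fun k : ℕ => ⨍ y in Metric.ball x (1 / ((k : ℝ) + 1)), φ y) atTop,
    Measurable.limsup fun k => measurable_setAverage_ball hφ _, fun x l hl => ?_⟩
  refine Tendsto.limsup_eq ((hl.tendsto_setAverage hφ).comp ?_)
  exact tendsto_nhdsWithin_iff.2 ⟨tendsto_one_div_add_atTop_nhds_zero_nat,
    Eventually.of_forall fun k => Set.mem_Ioi.2 (by positivity)⟩

/-- Covers `n = 0`, where the exponent `1 - s` need not be negative and the decay argument does not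
apply. -/
theorem hasApproxLimit_of_subsingleton [Subsingleton (E n)] (x : E n) :
    HasApproxLimit φ x (φ x) := by
  have : ∀ y, |φ y - φ x| = 0 := fun y => by simp [Subsingleton.elim y x]
  simp [HasApproxLimit, this]

/-! ### From a finite potential to an approximate limit. -/

namespace IsBVLoc

/-- The deviation of `φ y` from the mean is at most the average of `|φ w - φ y|` over `w`, which
reduces the claim to the double integral; one factor `V` cancels against `volume (B(0,2r)) = 2^n V`.
-/
theorem setAverage_abs_sub_setAverage_le (hφ : IsBVLoc φ) (x : E n) {r : ℝ} (hr : 0 < r) :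
    ⨍ y in Metric.ball x r, |φ y - ⨍ w in Metric.ball x r, φ w| ≤
      2 ^ n * n * (2 * r) * hφ.totalVariation.real (Metric.ball x (4 * r)) /
        volume.real (Metric.ball x r) := by
  set m := ⨍ w in Metric.ball x r, φ w
  set V := volume (Metric.ball x r) with hVdef
  have hV0 : V ≠ 0 := (Metric.measure_ball_pos volume x hr).ne'
  have hVt : V ≠ ∞ := measure_ball_lt_top.ne
  have hφi := integrableOn_ball hφ.locallyIntegrable x r
  have hpt : ∀ y, V * ‖φ y - m‖ₑ ≤ ∫⁻ w in Metric.ball x r, ‖φ w - φ y‖ₑ := by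
    intro y
    have e : ∫ w in Metric.ball x r, (φ w - φ y) = V.toReal * (m - φ y) := by
      rw [integral_sub hφi (integrableOn_const hVt)]
      simp only [m, setAverage_eq, smul_eq_mul, integral_const, Measure.real,
        Measure.restrict_apply_univ, ← hVdef]
      have := ENNReal.toReal_pos hV0 hVt
      field_simp
    refine le_trans (le_of_eq ?_) (enorm_integral_le_lintegral_enorm _)
    rw [e, enorm_mul, Real.enorm_of_nonneg ENNReal.toReal_nonneg, ENNReal.ofReal_toReal hVt,
      enorm_sub_rev]
  have h1 := (lintegral_mono hpt).trans (hφ.lintegral_lintegral_sub_le x hr)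
  rw [lintegral_const_mul' _ _ hVt, volume_ball_two_mul 0 x, mul_comm (2 ^ n), mul_assoc,
    ENNReal.mul_le_mul_iff_right hV0 hVt] at h1
  rw [setAverage_eq, smul_eq_mul, ← div_eq_inv_mul]
  gcongr
  have hnu : hφ.totalVariation (Metric.ball x (4 * r)) ≠ ∞ :=
    (hφ.totalVariation_lt_top Metric.isBounded_ball).ne
  simp_rw [← Real.norm_eq_abs]
  rw [integral_norm_eq_lintegral_enorm (f := fun y => φ y - m)
    (hφi.aestronglyMeasurable.sub aestronglyMeasurable_const)]
  refine (ENNReal.toReal_mono (by finiteness) h1).trans (le_of_eq ?_)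
  simp [Measure.real, hr.le, mul_assoc]

/-- At points where the Riesz type potential of the total variation is finite, a function of
locally bounded variation has an approximate limit. -/
theorem exists_hasApproxLimit_of_potential_lt_top (hφ : IsBVLoc φ) {s : ℝ} (hs : 0 < s)
    {U : Set (E n)} (hU : IsOpen U) {x : E n} (hx : x ∈ U)
    (hfin : ∫⁻ z in U, ‖x - z‖ₑ ^ (-(n : ℝ) + 1 - s) ∂hφ.totalVariation < ∞) :
    ∃ l, HasApproxLimit φ x l := by
  rcases Nat.eq_zero_or_pos n with rfl | hn
  · exact ⟨_, hasApproxLimit_of_subsingleton x⟩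
  obtain ⟨R, hR, hRU⟩ := Metric.isOpen_iff.1 hU x hx
  set K := ∫⁻ z in U, ‖x - z‖ₑ ^ (-(n : ℝ) + 1 - s) ∂hφ.totalVariation with hK
  set p : ℝ := n - 1 + s with hp
  have hn1 : (1 : ℝ) ≤ n := by exact_mod_cast hn
  have hp0 : 0 < p := by linarith
  have hdecay : ∀ r, 0 < r → r ≤ R →
      hφ.totalVariation.real (Metric.ball x r) ≤ K.toReal * r ^ p := by
    intro r hr hrR
    -- Chebyshev: the kernel is at least `r^(-p)` on `B(x,r)`, which is contained in `U`.
    have h1 : (ENNReal.ofReal (r ^ p))⁻¹ * hφ.totalVariation (Metric.ball x r) ≤ K := by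
      rw [← setLIntegral_const, hK]
      refine (setLIntegral_mono' measurableSet_ball fun z hz => ?_).trans
        (lintegral_mono_set ((Metric.ball_subset_ball hrR).trans hRU))
      rw [show -(n : ℝ) + 1 - s = -p by rw [hp]; ring, ENNReal.rpow_neg,
        ← ENNReal.ofReal_rpow_of_pos hr, ← ofReal_norm, ← dist_eq_norm, dist_comm]
      gcongr
      exact hz.le
    have h2 : 0 < r ^ p := by positivity
    have h3 := ENNReal.toReal_mono hfin.ne h1
    rw [ENNReal.toReal_mul, ENNReal.toReal_inv, ENNReal.toReal_ofReal h2.le,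
      inv_mul_le_iff₀ h2] at h3
    rwa [mul_comm]
  set V₁ := volume.real (Metric.ball (0 : E n) 1) with hV₁
  have hV₁0 : 0 < V₁ := volume_real_ball_pos 0 one_pos
  -- The oscillation on `B(x,r)` involves `B(x,4r)`, so decay up to radius `R` is usable only for `r
  -- ≤ R / 4`.
  refine exists_hasApproxLimit_of_oscillation_le (R := R / 4)
    (C := 2 ^ n * n * 2 * (K.toReal * 4 ^ p) / V₁) hφ.locallyIntegrable (by positivity) hs
    fun r hr hrR => (hφ.setAverage_abs_sub_setAverage_le x hr).trans ?_
  have hV : volume.real (Metric.ball x r) = r ^ n * V₁ := by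
    rw [hV₁, Measure.real, Measure.real, Measure.addHaar_ball_of_pos volume x hr,
      finrank_euclideanSpace_fin, ENNReal.toReal_mul, ENNReal.toReal_ofReal (by positivity)]
  have h4 := hdecay (4 * r) (by positivity) (by linarith)
  have h5 : (4 * r) ^ p * r = 4 ^ p * (r ^ n * r ^ s) := by
    rw [Real.mul_rpow (by norm_num) hr.le, mul_assoc, ← Real.rpow_natCast r n,
      ← Real.rpow_add hr]
    nth_rw 2 [← Real.rpow_one r]
    rw [← Real.rpow_add hr]
    congr 2
    rw [hp]; ring
  rw [hV]
  calc 2 ^ n * n * (2 * r) * hφ.totalVariation.real (Metric.ball x (4 * r)) / (r ^ n * V₁)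
      ≤ 2 ^ n * n * (2 * r) * (K.toReal * (4 * r) ^ p) / (r ^ n * V₁) := by gcongr
    _ = 2 ^ n * n * 2 * K.toReal * ((4 * r) ^ p * r) / (r ^ n * V₁) := by ring
    _ = _ := by rw [h5]; field_simp

/-- The Riesz type potential of the total variation restricted to a set is a Borel function. -/
theorem measurable_potential (hφ : IsBVLoc φ) (U : Set (E n)) (p : ℝ) :
    Measurable fun x => ∫⁻ z in U, ‖x - z‖ₑ ^ p ∂hφ.totalVariation := by
  refine Measurable.lintegral_prod_right' (f := fun q : E n × E n => ‖q.1 - q.2‖ₑ ^ p) ?_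
  exact (measurable_fst.sub measurable_snd).enorm.pow_const p

end IsBVLoc

/-! ### Composition with the path and the main theorem. -/

theorem IsLebesgueRepresentative.comp_ae_eq {T : ℝ} {X : ℝ → E n} {ψ₁ ψ₂ : E n → ℝ}
    (h₁ : IsLebesgueRepresentative φ ψ₁) (h₂ : IsLebesgueRepresentative φ ψ₂)
    (hX : ∀ᵐ t ∂volume.restrict (Set.Icc 0 T), ∃ l, HasApproxLimit φ (X t) l) :
    (fun t => ψ₁ (X t)) =ᵐ[volume.restrict (Set.Icc 0 T)] fun t => ψ₂ (X t) := by
  filter_upwards [hX] with t ⟨l, hl⟩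
  rw [h₁.eq_approxLimit _ l hl, h₂.eq_approxLimit _ l hl]

end BVPath

end

theorem corollaryC {n : ℕ} {φ : BVPath.E n → ℝ} (hφ : BVPath.IsBVLoc φ)
    {T s : ℝ} (hT : 0 < T) (hs : s ∈ Set.Ioo (0 : ℝ) 1)
    {X : ℝ → BVPath.E n} (hX : ContinuousOn X (Set.Icc 0 T))
    (hvar : BVPath.IsVariable hφ T s 1 X) :
    -- the approximate discontinuity set is null for the occupation measure
    BVPath.occupationMeasure T X (BVPath.approxDiscontSet φ) = 0 ∧
    -- the path lies outside it for almost every time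
    volume {t | t ∈ Set.Icc 0 T ∧ X t ∈ BVPath.approxDiscontSet φ} = 0 ∧
    -- the composition is a well-defined class
    (∃! F : ℝ →ₘ[volume.restrict (Set.Icc 0 T)] ℝ, BVPath.IsComposition φ T X F) ∧
    -- the bound for the norm in `L^∞(X)`
    (∀ F : ℝ →ₘ[volume.restrict (Set.Icc 0 T)] ℝ, BVPath.IsComposition φ T X F →
      eLpNorm F ∞ (volume.restrict (Set.Icc 0 T)) ≤ eLpNorm φ ∞ volume) := by
  obtain ⟨U, hU, -, hXU, hmem⟩ := hvar
  have hXm : AEMeasurable X (volume.restrict (Set.Icc 0 T)) :=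
    hX.aemeasurable measurableSet_Icc
  have hfin : ∀ᵐ t ∂volume.restrict (Set.Icc 0 T),
      ∫⁻ z in U, ‖X t - z‖ₑ ^ (-(n : ℝ) + 1 - s) ∂hφ.totalVariation < ∞ := by
    rw [← restrict_Ioo_eq_restrict_Icc]
    refine ae_lt_top' hmem.aestronglyMeasurable.aemeasurable ?_
    have := hmem.eLpNorm_lt_top.ne
    rwa [eLpNorm_one_eq_lintegral_enorm] at this
  have hmemU : ∀ᵐ t ∂volume.restrict (Set.Icc 0 T), X t ∈ U :=
    (ae_restrict_iff' measurableSet_Icc).2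
      (Filter.Eventually.of_forall fun t ht => hXU (Set.mem_image_of_mem X ht))
  have hlim : ∀ᵐ t ∂volume.restrict (Set.Icc 0 T), ∃ l, BVPath.HasApproxLimit φ (X t) l := by
    filter_upwards [hfin, hmemU] with t h1 h2
    exact hφ.exists_hasApproxLimit_of_potential_lt_top hs.1 hU h2 h1
  refine ⟨?_, ?_, ?_, ?_⟩
  -- Measurability of `S_φ` is not established; it is covered by the complement of the Borel set
  -- where the potential is finite, whose preimage under `X` is null.
  · have hmeas : MeasurableSet (U ∩ {x | ∫⁻ z in U, ‖x - z‖ₑ ^ (-(n : ℝ) + 1 - s)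
        ∂hφ.totalVariation < ∞}) :=
      hU.measurableSet.inter (measurableSet_lt (hφ.measurable_potential U _) measurable_const)
    have h0 : BVPath.occupationMeasure T X (U ∩ {x | ∫⁻ z in U, ‖x - z‖ₑ ^ (-(n : ℝ) + 1 - s)
        ∂hφ.totalVariation < ∞})ᶜ = 0 := by
      rw [BVPath.occupationMeasure, Measure.map_apply_of_aemeasurable hXm hmeas.compl]
      change ∀ᵐ t ∂volume.restrict (Set.Icc 0 T), X t ∈ U ∩ _
      filter_upwards [hfin, hmemU] with t h1 h2 using ⟨h2, h1⟩
    refine measure_mono_null (fun x hx => ?_) h0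
    intro hx'
    exact hx <| hφ.exists_hasApproxLimit_of_potential_lt_top hs.1 hU hx'.1 hx'.2
  · have h := (ae_restrict_iff' measurableSet_Icc).1 hlim
    refine measure_mono_null (fun t ht => ?_) h
    exact fun h' => ht.2 (h' ht.1)
  · obtain ⟨ψ, hψ⟩ := BVPath.exists_isLebesgueRepresentative hφ.locallyIntegrable
    have hψX : AEStronglyMeasurable (fun t => ψ (X t)) (volume.restrict (Set.Icc 0 T)) :=
      (hψ.measurable.comp_aemeasurable hXm).aestronglyMeasurable
    refine ⟨AEEqFun.mk _ hψX, ⟨ψ, hψ, AEEqFun.coeFn_mk _ hψX⟩, ?_⟩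
    rintro F ⟨ψ', hψ', hF⟩
    refine AEEqFun.ext (hF.trans ?_)
    exact (hψ'.comp_ae_eq hψ hlim).trans (AEEqFun.coeFn_mk _ hψX).symm
  · rintro F ⟨ψ, hψ, hF⟩
    rcases eq_or_ne (eLpNorm φ ∞ volume) ∞ with htop | htop
    · rw [htop]; exact le_top
    have hM : ∀ᵐ y, |φ y| ≤ (eLpNorm φ ∞ volume).toReal := by
      filter_upwards [ae_le_eLpNormEssSup (f := φ) (μ := volume)] with y hy
      rw [← eLpNorm_exponent_top] at hy
      simpa using ENNReal.toReal_mono htop hy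
    rw [eLpNorm_congr_ae hF, eLpNorm_exponent_top]
    refine eLpNormEssSup_le_of_ae_enorm_bound ?_
    filter_upwards [hlim] with t ⟨l, hl⟩
    rw [hψ.eq_approxLimit _ l hl, ← ofReal_norm, Real.norm_eq_abs]
    exact ENNReal.ofReal_le_of_le_toReal (hl.abs_le hφ.locallyIntegrable hM)
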